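/- Theorem (Fatou). Let $f:\mathbb{C}\to\mathbb{C}$ be a polynomial with complex coefficients of degree $d\geq 2$, and let $$\mathcal{K}_f=\Big\{z\in\mathbb{C}~\Big|~\bigl(f^{\circ n}(z)\bigr)_{n\in\mathbb{N}}\text{ is bounded}\Big\}$$ be its filled-in Julia set, where $f^{\circ n}$ denotes the $n$-th iterate of $f$. Then $\mathcal{K}_f$ is connected if and only if every critical point of $f$ in $\mathbb{C}$, i.e. every $c\in\mathbb{C}$ with $f'(c)=0$, belongs to $\mathcal{K}_f$. -/

import Mathlib

open Polynomial

/-- The filled-in Julia set of a complex polynomial `f`: the set of points of the complex plane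
whose forward orbit under `f` is bounded. -/
def filledJuliaSet (f : ℂ[X]) : Set ℂ :=
  {z : ℂ | Bornology.IsBounded (Set.range fun n : ℕ => (fun w : ℂ => f.eval w)^[n] z)}

/-- The (finite) critical points of a complex polynomial `f`: the points of the complex plane at
which the derivative of `f`, as a function on the plane, vanishes. -/
def finiteCriticalPoints (f : ℂ[X]) : Set ℂ :=
  {z : ℂ | deriv (fun w : ℂ => f.eval w) z = 0}

/-! ### Polynomials as proper open maps -/

open Filter Topology Set Metric

/-! Choose `R` with `|f(z)| ≥ 2|z|` for `|z| ≥ R`. Then `K_f` is the decreasing intersection of the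
domains `L_n = {|f^n| < R}`, and the question is how the connectedness of `{|F| < s}` depends on the
critical points of `F = f^n`.

If no critical point escapes, `F` has none where `|F| ≥ R`. As the level decreases from a large
value, a domain can split only at a critical level
(`isPreconnected_lemniscate_of_derivative_ne_zero`), so every `L_n` is connected, and so is `K_f`.

Conversely, if `{|F| < s}` is connected, `F` has an analytic root of order `N = deg F` on `{|F| >
s}`. This root maps onto `{|w|^N > s}`, so values of modulus above `s` have `N` distinct preimages
and no critical point lies there (`derivative_eval_ne_zero_of_isPreconnected_lemniscate`). An
escaping critical point therefore disconnects some `L_n`; each piece maps onto the disc of radius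
`R`, hence meets `K_f`, which is split too. -/

theorem Polynomial.isCompact_setOf_norm_eval_le {F : ℂ[X]} (hF : 0 < F.natDegree) (s : ℝ) :
    IsCompact {z : ℂ | ‖F.eval z‖ ≤ s} := by
  have h := F.tendsto_norm_atTop (natDegree_pos_iff_degree_pos.mp hF)
    (tendsto_norm_cocompact_atTop (E := ℂ))
  obtain ⟨t, ht, hts⟩ := mem_cocompact'.mp (h.eventually (eventually_gt_atTop s))
  refine ht.of_isClosed_subset (isClosed_le (by fun_prop) continuous_const) fun z hz => hts ?_
  simpa using hz

theorem Polynomial.not_eventually_eval_eq {F : ℂ[X]} (hF : 0 < F.natDegree) (z c : ℂ) :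
    ¬ ∀ᶠ w in 𝓝 z, F.eval w = c := fun h => by
  have hsub : interior {w | F.eval w = c} ⊆ {w | F.eval w = c} := interior_subset
  have hz : z ∈ interior {w | F.eval w = c} := mem_interior_iff_mem_nhds.mpr h
  have hU := (F.isOpenQuotientMap_eval hF.ne').isOpenMap _
    (isOpen_interior (s := {w | F.eval w = c}))
  have himg : (fun w => F.eval w) '' interior {w | F.eval w = c} = {c} :=
    Subset.antisymm (image_subset_iff.mpr hsub) (singleton_subset_iff.mpr ⟨z, hz, hsub hz⟩)
  exact not_isOpen_singleton c (himg ▸ hU)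

theorem Polynomial.nhds_eval_le_map {F : ℂ[X]} (hF : 0 < F.natDegree) (z : ℂ) :
    𝓝 (F.eval z) ≤ Filter.map (fun w => F.eval w) (𝓝 z) :=
  (F.isOpenQuotientMap_eval hF.ne').isOpenMap.nhds_le z

/-- The image is open because `g` is open, and closed relative to `T` because `g` is proper over
`T`. -/
theorem subset_image_of_nhds_le_map_of_isCompact_preimage {g : ℂ → ℂ} {A T : Set ℂ}
    (hA : IsOpen A) (hne : A.Nonempty) (hg : ContinuousOn g A)
    (hopen : ∀ z ∈ A, 𝓝 (g z) ≤ Filter.map g (𝓝 z)) (hmaps : MapsTo g A T)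
    (hT : IsOpen T) (hTc : IsPreconnected T)
    (hproper : ∀ C ⊆ T, IsCompact C → IsCompact (A ∩ g ⁻¹' C)) : T ⊆ g '' A := by
  refine hTc.subset_of_closure_inter_subset ?_ ?_ ?_
  · rw [isOpen_iff_mem_nhds]
    rintro _ ⟨z, hz, rfl⟩
    exact hopen z hz (image_mem_map (hA.mem_nhds hz))
  · obtain ⟨z, hz⟩ := hne
    exact ⟨g z, hmaps hz, z, hz, rfl⟩
  · rintro w ⟨hw, hwT⟩
    obtain ⟨ε, hε, hball⟩ := Metric.nhds_basis_closedBall.mem_iff.mp (hT.mem_nhds hwT)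
    have hc := hproper _ hball (isCompact_closedBall w ε)
    have hcl := (hc.image_of_continuousOn (hg.mono inter_subset_left)).isClosed
    have : w ∈ closure (g '' (A ∩ g ⁻¹' closedBall w ε)) := by
      rw [mem_closure_iff_nhds] at hw ⊢
      intro t ht
      obtain ⟨_, ⟨hx, hx'⟩, z, hz, rfl⟩ := hw _ (inter_mem ht (closedBall_mem_nhds w hε))
      exact ⟨g z, hx, z, ⟨hz, hx'⟩, rfl⟩
    rw [hcl.closure_eq] at this
    exact image_mono inter_subset_left this

/-! ### Connectedness of lemniscate domains -/

/-- The open lemniscate domain of a polynomial. -/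
def lemniscate (F : ℂ[X]) (s : ℝ) : Set ℂ := {z | ‖F.eval z‖ < s}

theorem isOpen_lemniscate (F : ℂ[X]) (s : ℝ) : IsOpen (lemniscate F s) :=
  isOpen_lt (by fun_prop) continuous_const

theorem lemniscate_mono (F : ℂ[X]) {s t : ℝ} (h : s ≤ t) : lemniscate F s ⊆ lemniscate F t :=
  fun _ hz => lt_of_lt_of_le hz h

/-- On a clopen piece of the domain, `F` is still proper over the disc, hence onto it. -/
theorem exists_eval_eq_of_lemniscate_eq_union {F : ℂ[X]} (hF : 0 < F.natDegree) {s : ℝ}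
    {A B : Set ℂ} (hA : IsOpen A) (hB : IsOpen B) (hAB : Disjoint A B)
    (hU : lemniscate F s = A ∪ B) (hne : A.Nonempty) {w : ℂ} (hw : ‖w‖ < s) :
    ∃ z ∈ A, F.eval z = w := by
  have hAs : A ⊆ lemniscate F s := hU ▸ subset_union_left
  have := subset_image_of_nhds_le_map_of_isCompact_preimage (g := fun z => F.eval z)
    (T := ball 0 s) hA hne (by fun_prop) (fun z _ => nhds_eval_le_map hF z)
    (fun z hz => mem_ball_zero_iff.mpr (hAs hz)) isOpen_ball (convex_ball 0 s).isPreconnected ?_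
  · obtain ⟨z, hz, h⟩ := this (mem_ball_zero_iff.mpr hw)
    exact ⟨z, hz, h⟩
  · intro C hC hCc
    have : A ∩ (fun z => F.eval z) ⁻¹' C = Bᶜ ∩ (fun z => F.eval z) ⁻¹' C := by
      ext z
      constructor
      · exact fun h => ⟨disjoint_left.mp hAB h.1, h.2⟩
      · intro h
        have : z ∈ lemniscate F s := mem_ball_zero_iff.mp (hC h.2)
        rw [hU] at this
        exact ⟨this.resolve_right h.1, h.2⟩
    rw [this]
    refine (isCompact_setOf_norm_eval_le hF s).of_isClosed_subset
      (hB.isClosed_compl.inter (hCc.isClosed.preimage (by fun_prop))) fun z hz => ?_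
    exact (mem_ball_zero_iff.mp (hC hz.2)).le

theorem exists_separation_of_not_isPreconnected {L : Set ℂ} (hL : IsOpen L)
    (h : ¬ IsPreconnected L) : ∃ A B : Set ℂ, IsOpen A ∧ IsOpen B ∧ Disjoint A B ∧ L = A ∪ B ∧
      A.Nonempty ∧ B.Nonempty := by
  unfold IsPreconnected at h
  push Not at h
  obtain ⟨U, V, hU, hV, hLUV, hLU, hLV, hn⟩ := h
  refine ⟨L ∩ U, L ∩ V, hL.inter hU, hL.inter hV, ?_, ?_, hLU, hLV⟩
  · rw [disjoint_iff_inter_eq_empty, ← inter_inter_distrib_left]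
    exact hn
  · rw [← inter_union_distrib_left]
    exact (inter_eq_left.mpr hLUV).symm

/-- Each piece of a separation would contain a zero of `F`, so `γ` would be separated as well. -/
theorem isPreconnected_lemniscate_of_zeros_subset {F : ℂ[X]} (hF : 0 < F.natDegree) {s : ℝ}
    {γ : Set ℂ} (hγ : IsPreconnected γ) (hγs : γ ⊆ lemniscate F s)
    (hz : ∀ z, F.eval z = 0 → z ∈ γ) : IsPreconnected (lemniscate F s) := by
  by_contra h
  obtain ⟨A, B, hA, hB, hAB, hU, hAne, hBne⟩ :=
    exists_separation_of_not_isPreconnected (isOpen_lemniscate F s) h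
  have hs : ‖(0 : ℂ)‖ < s := by
    obtain ⟨z, hz⟩ := hAne
    have : z ∈ lemniscate F s := hU ▸ Or.inl hz
    simpa using (norm_nonneg _).trans_lt this
  obtain ⟨a, haA, ha⟩ := exists_eval_eq_of_lemniscate_eq_union hF hA hB hAB hU hAne hs
  obtain ⟨b, hbB, hb⟩ := exists_eval_eq_of_lemniscate_eq_union hF hB hA hAB.symm
    (hU.trans (union_comm A B)) hBne hs
  obtain ⟨x, -, hx⟩ := hγ A B hA hB (hU ▸ hγs) ⟨a, hz a ha, haA⟩ ⟨b, hz b hb, hbB⟩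
  exact disjoint_left.mp hAB hx.1 hx.2

theorem Polynomial.setOf_eval_eq_zero_finite {F : ℂ[X]} (hF : 0 < F.natDegree) :
    {z | F.eval z = 0}.Finite := by
  have h0 : F ≠ 0 := by rintro rfl; simp at hF
  refine (Finset.finite_toSet F.roots.toFinset).subset fun z hz => ?_
  simpa [h0] using hz

theorem exists_isPreconnected_lemniscate {F : ℂ[X]} (hF : 0 < F.natDegree) :
    ∃ M, ∀ s, M < s → IsPreconnected (lemniscate F s) := by
  obtain ⟨r, hr⟩ := (setOf_eval_eq_zero_finite hF).isBounded.subset_closedBall 0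
  obtain ⟨M, hM⟩ := (isCompact_closedBall (0 : ℂ) r).exists_bound_of_continuousOn
    (f := fun z => F.eval z) (by fun_prop)
  exact ⟨M, fun s hs => isPreconnected_lemniscate_of_zeros_subset hF
    (convex_closedBall 0 r).isPreconnected (fun z hz => (hM z hz).trans_lt hs) fun z hz => hr hz⟩

/-- A path in the domain through the finitely many zeros is compact, so `‖F‖` has a maximum below
`t` on it; this is the new level. -/
theorem exists_lt_isPreconnected_lemniscate {F : ℂ[X]} (hF : 0 < F.natDegree) {t : ℝ}
    (ht : 0 < t) (h : IsPreconnected (lemniscate F t)) :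
    ∃ s < t, ∀ s', s < s' → IsPreconnected (lemniscate F s') := by
  obtain ⟨a, ha⟩ := IsAlgClosed.exists_root F (natDegree_pos_iff_degree_pos.mp hF).ne'
  have hroot : ∀ z, F.eval z = 0 → z ∈ lemniscate F t := fun z hz => by
    simpa [lemniscate, hz] using ht
  have hp : IsPathConnected (lemniscate F t) :=
    (isOpen_lemniscate F t).isConnected_iff_isPathConnected.mp ⟨⟨a, hroot a ha⟩, h⟩
  have hfin := setOf_eval_eq_zero_finite hF
  obtain ⟨n, e⟩ : ∃ n : ℕ, Nonempty (Fin (n + 1) ≃ {z | F.eval z = 0}) := by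
    have := hfin.fintype
    have hne : Nonempty {z | F.eval z = 0} := ⟨⟨a, ha⟩⟩
    refine ⟨Fintype.card {z | F.eval z = 0} - 1, ⟨?_⟩⟩
    exact (finCongr (Nat.sub_add_cancel Fintype.card_pos)).trans (Fintype.equivFin _).symm
  obtain ⟨e⟩ := e
  obtain ⟨γ, hγ, hγe⟩ := hp.exists_path_through_family (fun i => (e i : ℂ))
    fun i => hroot _ (e i).2
  obtain ⟨x, hxγ, hx⟩ := (isCompact_range γ.continuous).exists_isMaxOn (range_nonempty γ)
    (f := fun z => ‖F.eval z‖) (by fun_prop)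
  refine ⟨‖F.eval x‖, hγ hxγ, fun s' hs' => isPreconnected_lemniscate_of_zeros_subset hF
    (isPreconnected_range γ.continuous) (fun z hz => (hx hz).trans_lt hs') fun z hz => ?_⟩
  simpa using hγe (e.symm ⟨z, hz⟩)

/-- At a common boundary point `F` is locally invertible, so the domain near it is the inverse image
of a convex intersection of two discs. That is connected and cannot meet both pieces. -/
theorem disjoint_closure_of_lemniscate_eq_union {F : ℂ[X]} {t : ℝ} {A B : Set ℂ}
    (hA : IsOpen A) (hB : IsOpen B) (hAB : Disjoint A B) (hU : lemniscate F t = A ∪ B)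
    (hcrit : ∀ z, ‖F.eval z‖ = t → F.derivative.eval z ≠ 0) :
    Disjoint (closure A) (closure B) := by
  rw [disjoint_left]
  intro z hzA hzB
  have hAs : A ⊆ lemniscate F t := hU ▸ subset_union_left
  have hBs : B ⊆ lemniscate F t := hU ▸ subset_union_right
  have hle : ‖F.eval z‖ ≤ t :=
    closure_minimal (show A ⊆ {w | ‖F.eval w‖ ≤ t} from fun w hw => mem_ofPred.mpr (hAs hw).le)
      (isClosed_le (by fun_prop) continuous_const) hzA
  rcases hle.lt_or_eq with hlt | heq
  · have hz : z ∈ A ∪ B := hU ▸ hlt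
    rcases hz with hz | hz
    · exact disjoint_left.mp (hAB.closure_right hA) hz hzB
    · exact disjoint_left.mp (hAB.closure_left hB) hzA hz
  · have hd := F.hasStrictDerivAt z
    set e := (hd.hasStrictFDerivAt_equiv (hcrit z heq)).toOpenPartialHomeomorph with he
    have hcoe : ∀ w, e w = F.eval w := fun w => rfl
    have hzs : z ∈ e.source := HasStrictFDerivAt.mem_toOpenPartialHomeomorph_source _
    obtain ⟨ε, hε, hball⟩ := Metric.nhds_basis_ball.mem_iff.mp
      (e.open_target.mem_nhds (e.map_source hzs))
    have hpre : IsPreconnected (e.symm '' (ball (F.eval z) ε ∩ ball 0 t)) :=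
      ((convex_ball _ _).inter (convex_ball _ _)).isPreconnected.image _
        (e.continuousOn_symm.mono fun w hw => hball hw.1)
    have hsub : e.symm '' (ball (F.eval z) ε ∩ ball 0 t) ⊆ A ∪ B := by
      rintro _ ⟨w, hw, rfl⟩
      rw [← hU]
      change ‖F.eval (e.symm w)‖ < t
      rw [← hcoe, e.right_inv (hball hw.1)]
      exact mem_ball_zero_iff.mp hw.2
    have hN : e.source ∩ (fun w => F.eval w) ⁻¹' ball (F.eval z) ε ∈ 𝓝 z :=
      inter_mem (e.open_source.mem_nhds hzs)
        (F.continuous.continuousAt.preimage_mem_nhds (ball_mem_nhds _ hε))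
    have hmem : ∀ w ∈ e.source ∩ (fun w => F.eval w) ⁻¹' ball (F.eval z) ε,
        w ∈ lemniscate F t → w ∈ e.symm '' (ball (F.eval z) ε ∩ ball 0 t) := fun w hw hwL =>
      ⟨F.eval w, ⟨hw.2, mem_ball_zero_iff.mpr hwL⟩, e.left_inv hw.1⟩
    obtain ⟨a, haN, haA⟩ := mem_closure_iff_nhds.mp hzA _ hN
    obtain ⟨b, hbN, hbB⟩ := mem_closure_iff_nhds.mp hzB _ hN
    obtain ⟨x, -, hx⟩ := hpre A B hA hB hsub ⟨a, hmem a haN (hAs haA), haA⟩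
      ⟨b, hmem b hbN (hBs hbB), hbB⟩
    exact disjoint_left.mp hAB hx.1 hx.2

theorem setOf_norm_eval_le_subset_closure_lemniscate {F : ℂ[X]} (hF : 0 < F.natDegree) {t : ℝ}
    (ht : 0 < t) : {z | ‖F.eval z‖ ≤ t} ⊆ closure (lemniscate F t) := by
  intro z hz
  have h := (F.isOpenQuotientMap_eval hF.ne').isOpenMap.preimage_closure_subset_closure_preimage
    (s := ball 0 t)
  have hL : (fun x => F.eval x) ⁻¹' ball 0 t = lemniscate F t := by
    ext w; simp [lemniscate]
  rw [hL, closure_ball _ ht.ne'] at h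
  exact h (by simpa using hz)

theorem exists_lemniscate_subset {F : ℂ[X]} (hF : 0 < F.natDegree) {t : ℝ} {W : Set ℂ}
    (hW : IsOpen W) (h : {z | ‖F.eval z‖ ≤ t} ⊆ W) : ∃ s > t, lemniscate F s ⊆ W := by
  have hc : IsCompact ({z | ‖F.eval z‖ ≤ t + 1} ∩ Wᶜ) :=
    (isCompact_setOf_norm_eval_le hF _).inter_right hW.isClosed_compl
  rcases ({z | ‖F.eval z‖ ≤ t + 1} ∩ Wᶜ).eq_empty_or_nonempty with he | hne
  · refine ⟨t + 1, by linarith, fun z hz => ?_⟩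
    by_contra hzW
    have hz' : ‖F.eval z‖ < t + 1 := hz
    exact he.subset ⟨hz'.le, hzW⟩
  · obtain ⟨x, hx, hmin⟩ := hc.exists_isMinOn hne (f := fun z => ‖F.eval z‖) (by fun_prop)
    refine ⟨‖F.eval x‖, lt_of_not_ge fun hle => hx.2 (h hle), fun z hz => ?_⟩
    by_contra hzW
    have hz' : ‖F.eval z‖ < ‖F.eval x‖ := hz
    have hle : ‖F.eval x‖ ≤ ‖F.eval z‖ := hmin ⟨hz'.le.trans hx.1, hzW⟩
    exact hle.not_gt hz'

/-- Consider the supremum of the disconnected levels. It is itself disconnected, since connectedness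
passes to slightly lower levels; but the closures of its pieces are disjoint, so slightly higher
levels are disconnected too. -/
theorem isPreconnected_lemniscate_of_derivative_ne_zero {F : ℂ[X]} (hF : 0 < F.natDegree) {r : ℝ}
    (hr : 0 < r) (hcrit : ∀ z, r ≤ ‖F.eval z‖ → F.derivative.eval z ≠ 0) :
    IsPreconnected (lemniscate F r) := by
  by_contra hn
  obtain ⟨M, hM⟩ := exists_isPreconnected_lemniscate hF
  set D : Set ℝ := {s | r ≤ s ∧ ¬ IsPreconnected (lemniscate F s)} with hD
  have hDb : BddAbove D := ⟨M, fun s hs => le_of_not_gt fun h => hs.2 (hM s h)⟩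
  have hDr : r ∈ D := ⟨le_rfl, hn⟩
  have hrt : r ≤ sSup D := le_csSup hDb hDr
  have ht : ¬ IsPreconnected (lemniscate F (sSup D)) := by
    intro h
    obtain ⟨s, hs, hs'⟩ := exists_lt_isPreconnected_lemniscate hF (hr.trans_le hrt) h
    obtain ⟨u, hu, hsu⟩ := exists_lt_of_lt_csSup ⟨r, hDr⟩ hs
    exact hu.2 (hs' u hsu)
  obtain ⟨A, B, hA, hB, hAB, hU, hAne, hBne⟩ :=
    exists_separation_of_not_isPreconnected (isOpen_lemniscate F _) ht
  have hcl := disjoint_closure_of_lemniscate_eq_union hA hB hAB hU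
    fun z hz => hcrit z (hz ▸ hrt)
  obtain ⟨U, V, hUo, hVo, hAU, hBV, hUV⟩ := normal_separation isClosed_closure isClosed_closure hcl
  have hsub : {z | ‖F.eval z‖ ≤ sSup D} ⊆ U ∪ V := by
    refine (setOf_norm_eval_le_subset_closure_lemniscate hF (hr.trans_le hrt)).trans ?_
    rw [hU, closure_union]
    exact union_subset_union hAU hBV
  obtain ⟨s, hs, hsW⟩ := exists_lemniscate_subset hF (hUo.union hVo) hsub
  have hsL : A ∪ B ⊆ lemniscate F s := hU ▸ lemniscate_mono F hs.le
  refine absurd (le_csSup hDb (a := s) ⟨hrt.trans hs.le, fun hp => ?_⟩) (not_le.mpr hs)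
  obtain ⟨a, ha⟩ := hAne
  obtain ⟨b, hb⟩ := hBne
  obtain ⟨x, -, hx⟩ := hp U V hUo hVo hsW ⟨a, hsL (Or.inl ha), hAU (subset_closure ha)⟩
    ⟨b, hsL (Or.inr hb), hBV (subset_closure hb)⟩
  exact disjoint_left.mp hUV hx.1 hx.2

/-! ### Analytic roots outside a connected lemniscate domain -/

/-- Having an analytic logarithm of `(z - b)/(z - a)` on `E` is an equivalence relation on `a, b`.
It holds for nearby points, where the quotient is within distance 1 of 1, hence throughout the
connected set `L`. -/
theorem IsPreconnected.exists_log_sub_div_sub {L E : Set ℂ} (hL : IsOpen L)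
    (hLc : IsPreconnected L) (hLE : Disjoint L E) {a b : ℂ} (ha : a ∈ L) (hb : b ∈ L) :
    ∃ q : ℂ → ℂ, AnalyticOnNhd ℂ q E ∧ ∀ z ∈ E, Complex.exp (q z) * (z - a) = z - b := by
  refine hLc.induction₂ (fun a b => ∃ q : ℂ → ℂ, AnalyticOnNhd ℂ q E ∧
    ∀ z ∈ E, Complex.exp (q z) * (z - a) = z - b) ?_ ?_ ?_ ha hb
  · intro a ha
    obtain ⟨ε, hε, hball⟩ := Metric.isOpen_iff.mp hL a ha
    filter_upwards [mem_nhdsWithin_of_mem_nhds (ball_mem_nhds a hε)] with b hb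
    have hza : ∀ z ∈ E, z - a ≠ 0 := fun z hz h =>
      disjoint_left.mp hLE ha (sub_eq_zero.mp h ▸ hz)
    have hslit : ∀ z ∈ E, 1 + (a - b) / (z - a) ∈ Complex.slitPlane := by
      intro z hz
      refine Complex.mem_slitPlane_of_norm_lt_one ?_
      have h1 : ε ≤ ‖z - a‖ := by
        refine le_of_not_gt fun h => disjoint_left.mp hLE (hball ?_) hz
        rwa [mem_ball, dist_eq_norm]
      rw [norm_div, div_lt_one (hε.trans_le h1), norm_sub_rev, ← dist_eq_norm]
      exact hb.trans_le h1
    refine ⟨fun z => Complex.log (1 + (a - b) / (z - a)), fun z hz => ?_, fun z hz => ?_⟩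
    · exact (analyticAt_const.add (analyticAt_const.div (analyticAt_id.sub analyticAt_const)
        (hza z hz))).clog (hslit z hz)
    · rw [Complex.exp_log (Complex.slitPlane_ne_zero (hslit z hz)), add_mul, one_mul,
        div_mul_cancel₀ _ (hza z hz)]
      ring
  · rintro a b c - - - ⟨q, hq, hq'⟩ ⟨r, hr, hr'⟩
    refine ⟨fun z => r z + q z, hr.add hq, fun z hz => ?_⟩
    rw [Complex.exp_add, mul_assoc, hq' z hz, hr' z hz]
  · rintro a b - - ⟨q, hq, hq'⟩
    refine ⟨fun z => -q z, hq.neg, fun z hz => ?_⟩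
    rw [← hq' z hz, Complex.exp_neg, inv_mul_cancel_left₀ (Complex.exp_ne_zero _)]

theorem IsPreconnected.exists_log_prod_sub_div_pow {L E : Set ℂ} (hL : IsOpen L)
    (hLc : IsPreconnected L) (hLE : Disjoint L E) {b : ℂ} (hb : b ∈ L) (S : Multiset ℂ)
    (hS : ∀ a ∈ S, a ∈ L) :
    ∃ q : ℂ → ℂ, AnalyticOnNhd ℂ q E ∧
      ∀ z ∈ E, Complex.exp (q z) * (z - b) ^ S.card = (S.map fun a => z - a).prod := by
  induction S using Multiset.induction_on with
  | empty => exact ⟨fun _ => 0, fun z _ => analyticAt_const, by simp⟩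
  | cons a S ih =>
    obtain ⟨q, hq, hq'⟩ := ih fun x hx => hS x (Multiset.mem_cons_of_mem hx)
    obtain ⟨r, hr, hr'⟩ :=
      hLc.exists_log_sub_div_sub hL hLE hb (hS a (Multiset.mem_cons_self a S))
    refine ⟨fun z => r z + q z, hr.add hq, fun z hz => ?_⟩
    rw [Multiset.map_cons, Multiset.prod_cons, ← hq' z hz, ← hr' z hz, Complex.exp_add,
      Multiset.card_cons]
    ring

theorem exists_analyticOnNhd_pow_natDegree_eq {F : ℂ[X]} (hF : 0 < F.natDegree) {L E : Set ℂ}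
    (hL : IsOpen L) (hLc : IsPreconnected L) (hLE : Disjoint L E)
    (hz : ∀ z, F.eval z = 0 → z ∈ L) :
    ∃ g : ℂ → ℂ, AnalyticOnNhd ℂ g E ∧ ∀ z ∈ E, g z ^ F.natDegree = F.eval z := by
  obtain ⟨b, hb⟩ := IsAlgClosed.exists_root F (natDegree_pos_iff_degree_pos.mp hF).ne'
  obtain ⟨q, hq, hq'⟩ := hLc.exists_log_prod_sub_div_pow hL hLE (hz b hb) F.roots
    fun a ha => hz a (isRoot_of_mem_roots ha)
  obtain ⟨c, hc⟩ := IsAlgClosed.exists_pow_nat_eq F.leadingCoeff hF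
  refine ⟨fun z => c * (Complex.exp (q z / F.natDegree) * (z - b)), fun z hz => ?_,
    fun z hz => ?_⟩
  · exact analyticAt_const.mul (((hq z hz).div_const).cexp.mul
      (analyticAt_id.sub analyticAt_const))
  · have hn : (F.natDegree : ℂ) ≠ 0 := Nat.cast_ne_zero.mpr hF.ne'
    rw [(IsAlgClosed.splits F).eval_eq_prod_roots, ← hq' z hz, mul_pow, mul_pow, hc,
      ← Complex.exp_nat_mul, mul_div_cancel₀ _ hn, IsAlgClosed.card_roots_eq_natDegree]

theorem isPreconnected_setOf_lt_norm_pow {s : ℝ} (hs : 0 < s) {N : ℕ} (hN : 0 < N) :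
    IsPreconnected {w : ℂ | s < ‖w‖ ^ N} := by
  have : {w : ℂ | s < ‖w‖ ^ N} = Complex.exp '' {x : ℂ | Real.log s / N < x.re} := by
    have hN' : (0 : ℝ) < N := Nat.cast_pos.mpr hN
    have key : ∀ x : ℂ, s < ‖Complex.exp x‖ ^ N ↔ Real.log s / N < x.re := fun x => by
      rw [Complex.norm_exp, ← Real.exp_nat_mul, ← Real.log_lt_iff_lt_exp hs, div_lt_iff₀' hN']
    ext w
    constructor
    · intro hw
      have hw0 : w ≠ 0 := by
        rintro rfl
        rw [mem_ofPred_eq, norm_zero, zero_pow hN.ne'] at hw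
        exact hw.not_gt hs
      refine ⟨Complex.log w, (key _).mp ?_, Complex.exp_log hw0⟩
      rwa [Complex.exp_log hw0]
    · rintro ⟨x, hx, rfl⟩
      exact (key x).mpr hx
  rw [this]
  exact (convex_halfSpace_re_gt _).isPreconnected.image _ Complex.continuous_exp.continuousOn

theorem Polynomial.surjOn_of_pow_natDegree_eq {F : ℂ[X]} (hF : 0 < F.natDegree) {s : ℝ} (hs : 0 < s)
    {g : ℂ → ℂ} (hg : AnalyticOnNhd ℂ g {z | s < ‖F.eval z‖})
    (hgF : ∀ z ∈ {z | s < ‖F.eval z‖}, g z ^ F.natDegree = F.eval z) :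
    {w : ℂ | s < ‖w‖ ^ F.natDegree} ⊆ g '' {z | s < ‖F.eval z‖} := by
  have hE : IsOpen {z | s < ‖F.eval z‖} := isOpen_lt continuous_const (by fun_prop)
  refine subset_image_of_nhds_le_map_of_isCompact_preimage hE ?_ hg.continuousOn ?_ ?_
    (isOpen_lt continuous_const (by fun_prop)) (isPreconnected_setOf_lt_norm_pow hs hF) ?_
  · obtain ⟨z, hz⟩ := (F.isOpenQuotientMap_eval hF.ne').surjective ((s + 1 : ℝ) : ℂ)
    refine ⟨z, ?_⟩
    simp only [mem_ofPred_eq, hz, Complex.norm_real, Real.norm_eq_abs]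
    exact (lt_add_one s).trans_le (le_abs_self _)
  · intro z hz
    refine (hg z hz).eventually_constant_or_nhds_le_map_nhds.resolve_left fun h => ?_
    refine not_eventually_eval_eq hF z (g z ^ F.natDegree) ?_
    filter_upwards [h, hE.mem_nhds hz] with w hw hwE
    rw [← hgF w hwE, hw]
  · intro z hz
    rw [mem_ofPred_eq, ← norm_pow, hgF z hz]
    exact hz
  · intro C hC hCc
    -- Properness of `g`: the preimage of `C` lies in the `F`-preimage of the set of powers of `C`,
    -- which is compact and stays inside the domain of `g`.
    have hC' : IsCompact ((fun w : ℂ => w ^ F.natDegree) '' C) := hCc.image (by fun_prop)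
    obtain ⟨M, hM⟩ := hC'.isBounded.subset_closedBall 0
    have hP : IsCompact ((fun z => F.eval z) ⁻¹' ((fun w : ℂ => w ^ F.natDegree) '' C)) :=
      (isCompact_setOf_norm_eval_le hF M).of_isClosed_subset
        (hC'.isClosed.preimage (by fun_prop)) fun z hz => mem_closedBall_zero_iff.mp (hM hz)
    have hPE : (fun z => F.eval z) ⁻¹' ((fun w : ℂ => w ^ F.natDegree) '' C) ⊆
        {z | s < ‖F.eval z‖} := by
      rintro z ⟨w, hw, hwz⟩
      have := hC hw
      simp only [mem_ofPred_eq] at this hwz ⊢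
      rwa [← hwz, norm_pow]
    have hEq : {z | s < ‖F.eval z‖} ∩ g ⁻¹' C =
        ((fun z => F.eval z) ⁻¹' ((fun w : ℂ => w ^ F.natDegree) '' C)) ∩ g ⁻¹' C := by
      ext z
      exact ⟨fun h => ⟨⟨g z, h.2, hgF z h.1⟩, h.2⟩, fun h => ⟨hPE h.1, h.2⟩⟩
    rw [hEq]
    exact hP.of_isClosed_subset ((hg.continuousOn.mono hPE).preimage_isClosed_of_isClosed
      hP.isClosed hCc.isClosed) inter_subset_left

/-- Since `g` attains each of the `natDegree` distinct roots of `w ^ F.natDegree = W`, the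
polynomial `F - C W` has only simple roots. -/
theorem derivative_eval_ne_zero_of_isPreconnected_lemniscate {F : ℂ[X]} (hF : 0 < F.natDegree)
    {s : ℝ} (hs : 0 < s) (hL : IsPreconnected (lemniscate F s)) {c : ℂ} (hc : s < ‖F.eval c‖) :
    F.derivative.eval c ≠ 0 := by
  intro hd
  have hdis : Disjoint (lemniscate F s) {z | s < ‖F.eval z‖} :=
    disjoint_left.mpr fun z (hz : ‖F.eval z‖ < s) (hz' : s < ‖F.eval z‖) =>
      hz.not_gt hz'
  obtain ⟨g, hg, hgF⟩ := exists_analyticOnNhd_pow_natDegree_eq hF (isOpen_lemniscate F s) hL hdis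
    fun z hz => by simpa [lemniscate, hz] using hs
  have hsurj := surjOn_of_pow_natDegree_eq hF hs hg hgF
  set W := F.eval c with hW
  have hW0 : W ≠ 0 := norm_pos_iff.mp (hs.trans hc)
  have hdeg : (F - C W).natDegree = F.natDegree := natDegree_sub_C
  have hne : F - C W ≠ 0 := by
    intro h0
    rw [h0] at hdeg
    simp [← hdeg] at hF
  have hprim := Complex.isPrimitiveRoot_exp F.natDegree hF.ne'
  have hcard : F.natDegree ≤ (F - C W).roots.toFinset.card := by
    have h1 : (nthRoots F.natDegree W).toFinset.card = F.natDegree := by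
      rw [Multiset.toFinset_card_of_nodup (hprim.nthRoots_nodup hW0), hprim.card_nthRoots,
        if_pos (IsAlgClosed.exists_pow_nat_eq W hF)]
    rw [← h1]
    refine Finset.card_le_card_of_surjOn g fun w hw => ?_
    have hw' : w ^ F.natDegree = W := by simpa [mem_nthRoots hF] using hw
    obtain ⟨z, hz, rfl⟩ := hsurj (show s < ‖w‖ ^ F.natDegree by rwa [← norm_pow, hw'])
    refine ⟨z, ?_, rfl⟩
    simp [hne, ← hgF z hz, hw']
  have hnodup : (F - C W).roots.Nodup := by
    refine Multiset.toFinset_card_eq_card_iff_nodup.mp (le_antisymm (Multiset.toFinset_card_le _) ?_)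
    exact ((card_roots' _).trans hdeg.le).trans hcard
  have h2 := Multiset.nodup_iff_count_le_one.mp hnodup c
  rw [count_roots] at h2
  refine absurd ((one_lt_rootMultiplicity_iff_isRoot hne).mpr ⟨?_, ?_⟩) (not_lt.mpr h2)
  · simp [IsRoot, hW]
  · simp [IsRoot, hd]

/-! ### Escape radius and iteration -/

theorem Polynomial.exists_two_mul_norm_le_norm_eval {f : ℂ[X]} (hf : 2 ≤ f.natDegree) :
    ∃ R > 0, ∀ z : ℂ, R ≤ ‖z‖ → 2 * ‖z‖ ≤ ‖f.eval z‖ := by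
  have hd : 0 < f.divX.natDegree := by
    rw [natDegree_divX_eq_natDegree_tsub_one]
    omega
  obtain ⟨r, hr⟩ := (isCompact_setOf_norm_eval_le hd 3).isBounded.subset_closedBall 0
  refine ⟨max (r + 1) (‖f.coeff 0‖ + 1), lt_max_of_lt_right (by positivity), fun z hz => ?_⟩
  -- The quotient contributes more than `3‖z‖`, and the constant coefficient costs at most `‖z‖`.
  have h1 : 3 < ‖f.divX.eval z‖ := by
    refine lt_of_not_ge fun h => ?_
    have := mem_closedBall_zero_iff.mp (hr h)
    linarith [le_max_left (r + 1) (‖f.coeff 0‖ + 1)]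
  have h2 : ‖f.coeff 0‖ ≤ ‖z‖ := by linarith [le_max_right (r + 1) (‖f.coeff 0‖ + 1)]
  have h3 : f.eval z = f.divX.eval z * z + f.coeff 0 := by
    conv_lhs => rw [← f.divX_mul_X_add]
    simp
  have h4 : ‖f.divX.eval z * z‖ ≤ ‖f.eval z‖ + ‖f.coeff 0‖ := by
    rw [show f.divX.eval z * z = f.eval z - f.coeff 0 by rw [h3]; ring]
    exact norm_sub_le _ _
  rw [norm_mul] at h4
  nlinarith [norm_nonneg z]

section EscapeRadius

variable {f : ℂ[X]} {R : ℝ}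

theorem le_norm_iterate_eval (hR : 0 < R) (h : ∀ z : ℂ, R ≤ ‖z‖ → 2 * ‖z‖ ≤ ‖f.eval z‖) {z : ℂ}
    (hz : R ≤ ‖z‖) (n : ℕ) : 2 ^ n * R ≤ ‖(fun w => f.eval w)^[n] z‖ := by
  induction n with
  | zero => simpa using hz
  | succ n ih =>
    rw [Function.iterate_succ_apply']
    have h1 : R ≤ 2 ^ n * R := le_mul_of_one_le_left hR.le (one_le_pow₀ one_le_two)
    have := h _ (h1.trans ih)
    rw [pow_succ]
    linarith

theorem mem_filledJuliaSet_iff (hR : 0 < R) (h : ∀ z : ℂ, R ≤ ‖z‖ → 2 * ‖z‖ ≤ ‖f.eval z‖) {z : ℂ} :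
    z ∈ filledJuliaSet f ↔ ∀ n : ℕ, ‖(fun w => f.eval w)^[n] z‖ < R := by
  rw [filledJuliaSet, mem_ofPred_eq]
  constructor
  · intro hz n
    by_contra hn
    obtain ⟨M, hM⟩ := isBounded_iff_forall_norm_le.mp hz
    obtain ⟨k, hk⟩ := pow_unbounded_of_one_lt (M / R) one_lt_two
    have h1 := le_norm_iterate_eval hR h (not_lt.mp hn) k
    rw [← Function.iterate_add_apply] at h1
    have h2 := hM _ ⟨k + n, rfl⟩
    rw [div_lt_iff₀ hR] at hk
    exact absurd (h1.trans h2) (not_le.mpr hk)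
  · intro hz
    refine isBounded_iff_forall_norm_le.mpr ⟨R, ?_⟩
    rintro _ ⟨n, rfl⟩
    exact (hz n).le

theorem mem_filledJuliaSet_of_eval_mem (z : ℂ) (hz : f.eval z ∈ filledJuliaSet f) :
    z ∈ filledJuliaSet f := by
  rw [filledJuliaSet, mem_ofPred_eq] at hz ⊢
  have : range (fun n : ℕ => (fun w : ℂ => f.eval w)^[n] z) ⊆
      insert z (range fun n : ℕ => (fun w : ℂ => f.eval w)^[n] (f.eval z)) := by
    rintro _ ⟨_ | n, rfl⟩
    · exact Or.inl rfl
    · exact Or.inr ⟨n, rfl⟩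
  exact (hz.insert z).subset this

theorem mem_filledJuliaSet_of_iterate_mem {n : ℕ} {z : ℂ}
    (hz : (fun w => f.eval w)^[n] z ∈ filledJuliaSet f) : z ∈ filledJuliaSet f := by
  induction n generalizing z with
  | zero => exact hz
  | succ n ih => exact mem_filledJuliaSet_of_eval_mem z (ih hz)

theorem filledJuliaSet_nonempty (hf : 2 ≤ f.natDegree) : (filledJuliaSet f).Nonempty := by
  have hd : (f - X).natDegree = f.natDegree :=
    natDegree_sub_eq_left_of_natDegree_lt (by rw [natDegree_X]; omega)
  obtain ⟨z, hz⟩ := IsAlgClosed.exists_root (f - X)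
    (natDegree_pos_iff_degree_pos.mp (by omega)).ne'
  have hfix : f.eval z = z := by simpa [IsRoot, sub_eq_zero] using hz
  refine ⟨z, (finite_singleton z).isBounded.subset ?_⟩
  rintro _ ⟨n, rfl⟩
  exact Function.iterate_fixed hfix n

theorem iterate_comp_X_eval (n : ℕ) (z : ℂ) :
    (f.comp^[n] X).eval z = (fun w => f.eval w)^[n] z := by
  rw [iterate_comp_eval, eval_X]

theorem natDegree_iterate_comp_X_pos (hf : 2 ≤ f.natDegree) (n : ℕ) :
    0 < (f.comp^[n] X).natDegree := by
  rw [natDegree_iterate_comp, natDegree_X, mul_one]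
  exact pow_pos (by omega) n

theorem derivative_iterate_comp_X_succ (n : ℕ) (z : ℂ) :
    (derivative (f.comp^[n + 1] X)).eval z =
      (derivative f).eval ((fun w => f.eval w)^[n] z) * (derivative (f.comp^[n] X)).eval z := by
  rw [Function.iterate_succ_apply', derivative_comp, eval_mul, eval_comp, iterate_comp_X_eval,
    mul_comm]

theorem mem_finiteCriticalPoints {z : ℂ} :
    z ∈ finiteCriticalPoints f ↔ (derivative f).eval z = 0 := by
  rw [finiteCriticalPoints, mem_ofPred_eq, Polynomial.deriv]

theorem exists_iterate_mem_finiteCriticalPoints {n : ℕ} {z : ℂ}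
    (h : (derivative (f.comp^[n] X)).eval z = 0) :
    ∃ k, (fun w => f.eval w)^[k] z ∈ finiteCriticalPoints f := by
  induction n with
  | zero => simp at h
  | succ n ih =>
    rw [derivative_iterate_comp_X_succ] at h
    rcases mul_eq_zero.mp h with h | h
    · exact ⟨n, mem_finiteCriticalPoints.mpr h⟩
    · exact ih h

theorem derivative_iterate_comp_X_succ_eq_zero {z : ℂ} (hz : z ∈ finiteCriticalPoints f) (n : ℕ) :
    (derivative (f.comp^[n + 1] X)).eval z = 0 := by
  induction n with
  | zero => simpa [derivative_iterate_comp_X_succ] using mem_finiteCriticalPoints.mp hz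
  | succ n ih => rw [derivative_iterate_comp_X_succ, ih, mul_zero]

theorem norm_iterate_lt_of_norm_iterate_succ_le (hR : 0 < R)
    (h : ∀ z : ℂ, R ≤ ‖z‖ → 2 * ‖z‖ ≤ ‖f.eval z‖) {n : ℕ} {z : ℂ}
    (hz : ‖(fun w => f.eval w)^[n + 1] z‖ ≤ R) : ‖(fun w => f.eval w)^[n] z‖ < R := by
  by_contra hn
  rw [Function.iterate_succ_apply'] at hz
  linarith [h _ (not_lt.mp hn), not_lt.mp hn]

/-- The closed sublevel sets are compact and decrease to `K_f`, so one of them already lies in `W`.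
-/
theorem exists_lemniscate_iterate_subset (hf : 2 ≤ f.natDegree) (hR : 0 < R)
    (h : ∀ z : ℂ, R ≤ ‖z‖ → 2 * ‖z‖ ≤ ‖f.eval z‖) {W : Set ℂ} (hW : IsOpen W)
    (hKW : filledJuliaSet f ⊆ W) : ∃ n, lemniscate (f.comp^[n] X) R ⊆ W := by
  have hanti : Antitone fun n : ℕ => {z | ‖(f.comp^[n] X).eval z‖ ≤ R} := by
    refine antitone_nat_of_succ_le fun n z hz => ?_
    simp only [mem_ofPred_eq, iterate_comp_X_eval] at hz ⊢
    exact (norm_iterate_lt_of_norm_iterate_succ_le hR h hz).le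
  obtain ⟨n, hn⟩ := exists_subset_nhds_of_isCompact hanti.directed_ge
    (fun n => isCompact_setOf_norm_eval_le (natDegree_iterate_comp_X_pos hf n) R) (U := W)
    fun z hz => hW.mem_nhds (hKW ((mem_filledJuliaSet_iff hR h).mpr fun n => by
      have := mem_iInter.mp hz (n + 1)
      rw [mem_ofPred_eq, iterate_comp_X_eval] at this
      exact norm_iterate_lt_of_norm_iterate_succ_le hR h this))
  exact ⟨n, fun z (hz : ‖(f.comp^[n] X).eval z‖ < R) => hn (mem_ofPred.mpr hz.le)⟩

theorem filledJuliaSet_subset_lemniscate (hR : 0 < R)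
    (h : ∀ z : ℂ, R ≤ ‖z‖ → 2 * ‖z‖ ≤ ‖f.eval z‖) (n : ℕ) :
    filledJuliaSet f ⊆ lemniscate (f.comp^[n] X) R := fun z hz => by
  rw [lemniscate, mem_ofPred_eq, iterate_comp_X_eval]
  exact (mem_filledJuliaSet_iff hR h).mp hz n

/-! ### The two implications -/

theorem isPreconnected_filledJuliaSet (hf : 2 ≤ f.natDegree)
    (hcrit : finiteCriticalPoints f ⊆ filledJuliaSet f) : IsPreconnected (filledJuliaSet f) := by
  obtain ⟨R, hR, h⟩ := exists_two_mul_norm_le_norm_eval hf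
  have hL : ∀ n, IsPreconnected (lemniscate (f.comp^[n] X) R) := fun n => by
    refine isPreconnected_lemniscate_of_derivative_ne_zero (natDegree_iterate_comp_X_pos hf n) hR
      fun z hz hd => ?_
    obtain ⟨k, hk⟩ := exists_iterate_mem_finiteCriticalPoints hd
    have := (mem_filledJuliaSet_iff hR h).mp (mem_filledJuliaSet_of_iterate_mem (hcrit hk)) n
    rw [iterate_comp_X_eval] at hz
    exact hz.not_gt this
  have hKc : IsClosed (filledJuliaSet f) := by
    have : filledJuliaSet f = ⋂ n : ℕ, {z | ‖(f.comp^[n] X).eval z‖ ≤ R} := by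
      ext z
      rw [mem_filledJuliaSet_iff hR h, mem_iInter]
      simp only [mem_ofPred_eq, iterate_comp_X_eval]
      exact ⟨fun hz n => (hz n).le,
        fun hz n => norm_iterate_lt_of_norm_iterate_succ_le hR h (hz (n + 1))⟩
    rw [this]
    exact isClosed_iInter fun n => isClosed_le (by fun_prop) continuous_const
  rw [isPreconnected_closed_iff]
  intro A B hA hB hKAB ⟨a, haK, haA⟩ ⟨b, hbK, hbB⟩
  by_contra hne
  have hdis : Disjoint (filledJuliaSet f ∩ A) (filledJuliaSet f ∩ B) := by
    rw [disjoint_iff_inter_eq_empty, ← inter_inter_distrib_left]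
    exact not_nonempty_iff_eq_empty.mp hne
  obtain ⟨U, V, hU, hV, hAU, hBV, hUV⟩ :=
    normal_separation (hKc.inter hA) (hKc.inter hB) hdis
  obtain ⟨n, hn⟩ := exists_lemniscate_iterate_subset hf hR h (hU.union hV) fun z hz =>
    (hKAB hz).imp (fun hzA => hAU ⟨hz, hzA⟩) fun hzB => hBV ⟨hz, hzB⟩
  have hK := filledJuliaSet_subset_lemniscate hR h n
  obtain ⟨x, -, hx⟩ := hL n U V hU hV hn ⟨a, hK haK, hAU ⟨haK, haA⟩⟩ ⟨b, hK hbK, hBV ⟨hbK, hbB⟩⟩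
  exact disjoint_left.mp hUV hx.1 hx.2

theorem finiteCriticalPoints_subset_filledJuliaSet (hf : 2 ≤ f.natDegree)
    (hK : IsPreconnected (filledJuliaSet f)) : finiteCriticalPoints f ⊆ filledJuliaSet f := by
  obtain ⟨R, hR, h⟩ := exists_two_mul_norm_le_norm_eval hf
  intro c hc
  by_contra hcK
  rw [mem_filledJuliaSet_iff hR h] at hcK
  push Not at hcK
  obtain ⟨n, hn⟩ := hcK
  -- One extra iterate turns `R ≤` into the strict inequality and makes `c` critical even when `n =
  -- 0`.
  have hF := natDegree_iterate_comp_X_pos hf (n + 1)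
  have hesc : R < ‖(f.comp^[n + 1] X).eval c‖ := by
    rw [iterate_comp_X_eval, Function.iterate_succ_apply']
    linarith [h _ hn]
  have hL : ¬ IsPreconnected (lemniscate (f.comp^[n + 1] X) R) := fun hL =>
    derivative_eval_ne_zero_of_isPreconnected_lemniscate hF hR hL hesc
      (derivative_iterate_comp_X_succ_eq_zero hc n)
  obtain ⟨A, B, hA, hB, hAB, hU, hAne, hBne⟩ :=
    exists_separation_of_not_isPreconnected (isOpen_lemniscate _ _) hL
  -- Both pieces contain a preimage of `w`, which lies in `K_f` by backward invariance.
  obtain ⟨w, hw⟩ := filledJuliaSet_nonempty hf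
  have hwR : ‖w‖ < R := (mem_filledJuliaSet_iff hR h).mp hw 0
  obtain ⟨a, haA, ha⟩ := exists_eval_eq_of_lemniscate_eq_union hF hA hB hAB hU hAne hwR
  obtain ⟨b, hbB, hb⟩ := exists_eval_eq_of_lemniscate_eq_union hF hB hA hAB.symm
    (hU.trans (union_comm A B)) hBne hwR
  rw [iterate_comp_X_eval] at ha hb
  obtain ⟨x, -, hx⟩ := hK A B hA hB (hU ▸ filledJuliaSet_subset_lemniscate hR h (n + 1))
    ⟨a, mem_filledJuliaSet_of_iterate_mem (ha ▸ hw), haA⟩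
    ⟨b, mem_filledJuliaSet_of_iterate_mem (hb ▸ hw), hbB⟩
  exact disjoint_left.mp hAB hx.1 hx.2

end EscapeRadius

theorem mainTheorem2 (f : ℂ[X]) (hf : 2 ≤ f.natDegree) :
    IsConnected (filledJuliaSet f) ↔ finiteCriticalPoints f ⊆ filledJuliaSet f :=
  ⟨fun h => finiteCriticalPoints_subset_filledJuliaSet hf h.isPreconnected,
    fun h => ⟨filledJuliaSet_nonempty hf, isPreconnected_filledJuliaSet hf h⟩⟩
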